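/- For $w=\lambda+i\tau$ with $\lambda>0$, let $\varphi_w$ be the loxodromic isometry of $\mathbb{H}^3$ of complex length $w$ (it translates its axis by $\lambda$ and rotates about it by $\tau$), let $N_w=\mathbb{H}^3/\langle\varphi_w\rangle$ be the corresponding nonsingular solid torus, and let its core be the image of the axis, a closed geodesic of complex length $\lambda+i\tau$. For $x\in N_w$ let $\operatorname{injrad}(x)$ be the supremal $r>0$ such that the open $r$-ball about $x$ is isometric (as a Riemannian manifold) to a ball of radius $r$ in $\mathbb{H}^3$. For $s\ge\lambda$, let $r(s)\ge 0$ be the radius of the $s$-tube, that is, the number such that the points with $\operatorname{injrad}(x)=s/2$ are exactly the points at distance $r(s)$ from the core (if $s=\lambda$ these are the points of the core and $r(s)=0$). For $\lambda\le\delta<\epsilon$ let $d(\delta,\epsilon)=r(\epsilon)-r(\delta)$. **Theorem.** Let $0<\sqrt{7.256\,\delta}\le\epsilon\le 0.3$. Let $n$ be the least positive integer with $1/n^2\le\delta$, and let $N=N_{\lambda+i\tau}$ with $\lambda+i\tau=1/n^2+2\pi i/n$. Then $\lambda\le\delta$, the radii $r(\delta)$ and $r(\epsilon)$ of the tubes of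 $N$ exist, and $$d(\delta,\epsilon)\le\operatorname{arccosh}\Bigl(1.116\,\frac{\epsilon}{\sqrt\delta}\Bigr).$$ Moreover $$d(\delta,\epsilon)<\Bigl(\operatorname{arccosh}\frac{\epsilon}{\sqrt{7.256\,\delta}}-0.0424\Bigr)+2.2 ,$$ so that $d(\delta,\epsilon)$ exceeds the quantity $\max\bigl\{\tfrac{\epsilon-\delta}{2},\ \operatorname{arccosh}\tfrac{\epsilon}{\sqrt{7.256\,\delta}}-0.0424\bigr\}$ by less than $2.2$. -/

import Mathlib

/-- Hyperbolic `3`-space in the upper half-space model: points `(z, t)` with `z ∈ ℂ`, `t > 0`. -/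
@[ext]
structure HypSpace where
  z : ℂ
  t : ℝ
  t_pos : 0 < t

namespace HypSpace

/-- The hyperbolic distance of the upper half-space model (curvature `-1`):
`cosh d(p, q) = 1 + |p - q|² / (2 · height p · height q)`, with `|p - q|` Euclidean. -/
noncomputable def hdist (p q : HypSpace) : ℝ :=
  Real.arcosh (1 + (‖p.z - q.z‖ ^ 2 + (p.t - q.t) ^ 2) / (2 * p.t * q.t))

/-- The additive group `ℂ` acts on hyperbolic space by isometries preserving the geodesic
`{z = 0}`: the number `w` acts by the isometry of complex length `w`, which translates along the
geodesic by `re w` and rotates about it by the angle `im w`. -/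
noncomputable instance instAddActionComplex : AddAction ℂ HypSpace where
  vadd w p := ⟨Complex.exp w * p.z, Real.exp w.re * p.t, mul_pos (Real.exp_pos _) p.t_pos⟩
  zero_vadd p := by
    apply HypSpace.ext
    · change Complex.exp 0 * p.z = p.z
      simp
    · change Real.exp (0 : ℂ).re * p.t = p.t
      simp
  add_vadd v w p := by
    apply HypSpace.ext
    · change Complex.exp (v + w) * p.z = Complex.exp v * (Complex.exp w * p.z)
      rw [Complex.exp_add, mul_assoc]
    · change Real.exp (v + w).re * p.t = Real.exp v.re * (Real.exp w.re * p.t)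
      rw [Complex.add_re, Real.exp_add, mul_assoc]

end HypSpace

/-- The nonsingular solid torus `N = ℍ³ / ⟨φ⟩`, where `φ` is the isometry of complex length
`w = lam + i tau` (loxodromic when `lam > 0`). -/
abbrev SolidTorus (w : ℂ) : Type :=
  AddAction.orbitRel.Quotient (AddSubgroup.zmultiples w) HypSpace

namespace SolidTorus

/-- The covering projection `ℍ³ → N`. -/
noncomputable def proj (w : ℂ) (p : HypSpace) : SolidTorus w :=
  Quotient.mk _ p

/-- The distance of `N`: the infimum of the hyperbolic distances between lifts. -/
noncomputable def qdist {w : ℂ} (x y : SolidTorus w) : ℝ :=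
  sInf {d : ℝ | ∃ p q : HypSpace, proj w p = x ∧ proj w q = y ∧ d = p.hdist q}

/-- The core closed geodesic of `N`, the image of the axis `{z = 0}`. -/
def core (w : ℂ) : Set (SolidTorus w) :=
  {x | ∃ p : HypSpace, p.z = 0 ∧ proj w p = x}

/-- The distance from a point of `N` to the core. -/
noncomputable def coreDist {w : ℂ} (x : SolidTorus w) : ℝ :=
  sInf {d : ℝ | ∃ y ∈ core w, d = qdist x y}

/-- The open metric `r`-ball about `x` in `N` is isometric, as a Riemannian manifold, to an open
ball of radius `r` in `ℍ³`: there is a centre-preserving bijection between the two balls which, in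
both directions, preserves distances near each point. (The ball of `N` is not compared globally
through the distance of `N`, which may be realized by paths that leave the ball. All balls of
radius `r` in `ℍ³` are isometric, so their centre `c` does not matter.) -/
def IsHyperbolicBall {w : ℂ} (x : SolidTorus w) (r : ℝ) : Prop :=
  ∃ (c : HypSpace) (f : HypSpace → SolidTorus w),
    f c = x ∧
    Set.BijOn f {p | c.hdist p < r} {y | qdist x y < r} ∧
    (∀ p, c.hdist p < r → ∃ ρ : ℝ, 0 < ρ ∧ ∀ q q' : HypSpace, c.hdist q < r → c.hdist q' < r →
      p.hdist q < ρ → p.hdist q' < ρ → qdist (f q) (f q') = q.hdist q') ∧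
    (∀ p, c.hdist p < r → ∃ ρ : ℝ, 0 < ρ ∧ ∀ q q' : HypSpace, c.hdist q < r → c.hdist q' < r →
      qdist (f p) (f q) < ρ → qdist (f p) (f q') < ρ → q.hdist q' = qdist (f q) (f q'))

/-- The injectivity radius at `x`: the supremal radius of a ball about `x` that is isometric to a
ball of hyperbolic space. -/
noncomputable def injrad {w : ℂ} (x : SolidTorus w) : ℝ :=
  sSup {r : ℝ | 0 < r ∧ IsHyperbolicBall x r}

/-- `r` is the radius of the `ε`-tube of `N`: the points of injectivity radius exactly `ε / 2` are
exactly the points at distance `r` from the core. -/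
def IsTubeRadius (w : ℂ) (ε r : ℝ) : Prop :=
  0 ≤ r ∧ {x : SolidTorus w | injrad x = ε / 2} = {x : SolidTorus w | coreDist x = r}

/-- `d` is the distance `d(δ, ε)` between the boundaries of the `δ`-tube and the `ε`-tube of `N`:
both tubes have a radius, and `d` is the difference of the radii. -/
def IsTubeDist (w : ℂ) (δ ε d : ℝ) : Prop :=
  ∃ rδ rε : ℝ, IsTubeRadius w δ rδ ∧ IsTubeRadius w ε rε ∧ d = rε - rδ

end SolidTorus

/-! At distance `R` from the axis, the `k`-th power of the isometry of complex length `w = λ + iτ`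
has displacement `D` with `cosh D = cosh kλ + (cosh kλ - cos kτ) sinh² R`. The injectivity radius
there is half the least displacement over `k ≥ 1`. So the `s`-tube has radius `R` exactly when the
least displacement at `R` is `s`; since displacements increase with `R`, such a radius exists for
every `s ≥ λ`. For `λ = 1/n²`, `τ = 2π/n`, two regimes bound `r(ε)`. If `k < n`, the rotation is by
a nonzero multiple of `2π/n` modulo a full turn, and alone moves points far enough. If `k ≥ n`, the
translation is at least `nλ = 1/n`, about `√δ`, which at `cosh R = T` forces displacement at least
`ε` once `T` is slightly more than `nε`, about `ε/√δ`. Hence `cosh r(ε) ≤ 1.116 ε/√δ`, and `d ≤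
r(ε)` since `r(δ) ≥ 0`. The additive bound follows because the two arccosh arguments have bounded
ratio. The delicate point is the injectivity radius, as balls are compared only by local isometries.
An embedded ball cannot contain a nontrivial geodesic loop, because a local geodesic of `ℍ³` never
closes up (`local_geodesic_not_closed`). This gives `isHyperbolicBall_iff`, from which
`isTubeRadius_of_min` identifies the tubes. -/

namespace HypSpace

/-! ### The hyperbolic metric, through the hyperboloid model -/

/-- The hyperbolic cosine of the hyperbolic distance. -/
noncomputable def coshDist (p q : HypSpace) : ℝ :=
  1 + (‖p.z - q.z‖ ^ 2 + (p.t - q.t) ^ 2) / (2 * p.t * q.t)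

theorem one_le_coshDist (p q : HypSpace) : 1 ≤ coshDist p q := by
  have := p.t_pos
  have := q.t_pos
  unfold coshDist
  have : 0 ≤ (‖p.z - q.z‖ ^ 2 + (p.t - q.t) ^ 2) / (2 * p.t * q.t) := by positivity
  linarith

theorem cosh_hdist (p q : HypSpace) : Real.cosh (p.hdist q) = coshDist p q :=
  Real.cosh_arcosh (one_le_coshDist p q)

theorem hdist_nonneg (p q : HypSpace) : 0 ≤ p.hdist q :=
  Real.arcosh_nonneg (one_le_coshDist p q)

theorem hdist_eq_of_cosh {p q : HypSpace} {d : ℝ} (hd : 0 ≤ d) (h : coshDist p q = Real.cosh d) :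
    p.hdist q = d := by
  have : p.hdist q = Real.arcosh (coshDist p q) := rfl
  rw [this, h, Real.arcosh_cosh hd]

theorem le_hdist_iff {p q : HypSpace} {d : ℝ} (hd : 0 ≤ d) :
    d ≤ p.hdist q ↔ Real.cosh d ≤ coshDist p q := by
  rw [← cosh_hdist, Real.cosh_le_cosh, abs_of_nonneg hd, abs_of_nonneg (hdist_nonneg p q)]

theorem hdist_self (p : HypSpace) : p.hdist p = 0 :=
  hdist_eq_of_cosh le_rfl (by simp [coshDist])

theorem coshDist_comm (p q : HypSpace) : coshDist p q = coshDist q p := by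
  unfold coshDist
  rw [norm_sub_rev]
  ring

theorem hdist_comm (p q : HypSpace) : p.hdist q = q.hdist p :=
  hdist_eq_of_cosh (hdist_nonneg q p) (by rw [cosh_hdist, coshDist_comm])

theorem coshDist_eq (p q : HypSpace) : coshDist p q =
    ((p.z.re - q.z.re) ^ 2 + (p.z.im - q.z.im) ^ 2 + p.t ^ 2 + q.t ^ 2) / (2 * p.t * q.t) := by
  have := p.t_pos
  have := q.t_pos
  unfold coshDist
  rw [Complex.sq_norm, Complex.normSq_apply, Complex.sub_re, Complex.sub_im]
  field_simp
  ring

/-- Cauchy–Schwarz: `u`, `v`, `w` are the spacelike hyperboloid coordinates of a point when `b` is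
moved to the apex. It yields the triangle inequality through the addition formula for `cosh`. -/
theorem gram_coshDist (a b c : HypSpace) :
    (coshDist a b * coshDist b c - coshDist a c) ^ 2 ≤
      (coshDist a b ^ 2 - 1) * (coshDist b c ^ 2 - 1) := by
  have ha := a.t_pos.ne'
  have hb := b.t_pos.ne'
  have hc := c.t_pos.ne'
  obtain ⟨u, hu⟩ : ∃ u : HypSpace → ℝ, ∀ p, u p = (p.z.re - b.z.re) / p.t := ⟨_, fun _ => rfl⟩
  obtain ⟨v, hv⟩ : ∃ v : HypSpace → ℝ, ∀ p, v p = (p.z.im - b.z.im) / p.t := ⟨_, fun _ => rfl⟩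
  obtain ⟨w, hw⟩ : ∃ w : HypSpace → ℝ, ∀ p, w p =
    (b.t ^ 2 - (p.z.re - b.z.re) ^ 2 - (p.z.im - b.z.im) ^ 2 - p.t ^ 2) / (2 * p.t * b.t) :=
    ⟨_, fun _ => rfl⟩
  have h1 : coshDist a b ^ 2 - 1 = u a ^ 2 + v a ^ 2 + w a ^ 2 := by
    rw [hu, hv, hw, coshDist_eq]
    field_simp
    ring
  have h2 : coshDist b c ^ 2 - 1 = u c ^ 2 + v c ^ 2 + w c ^ 2 := by
    rw [hu, hv, hw, coshDist_eq]
    field_simp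
    ring
  have h3 : coshDist a b * coshDist b c - coshDist a c = u a * u c + v a * v c + w a * w c := by
    rw [hu, hv, hw, hu, hv, hw, coshDist_eq, coshDist_eq, coshDist_eq]
    field_simp
    ring
  rw [h1, h2, h3]
  nlinarith [sq_nonneg (u a * v c - v a * u c), sq_nonneg (u a * w c - w a * u c),
    sq_nonneg (v a * w c - w a * v c)]

theorem hdist_triangle (a b c : HypSpace) : a.hdist c ≤ a.hdist b + b.hdist c := by
  have h0 := hdist_nonneg a b
  have h1 := hdist_nonneg b c
  rw [← abs_of_nonneg (hdist_nonneg a c), ← abs_of_nonneg (add_nonneg h0 h1),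
    ← Real.cosh_le_cosh, Real.cosh_add]
  have hg := gram_coshDist a b c
  rw [← cosh_hdist, ← cosh_hdist, ← cosh_hdist, Real.cosh_sq', Real.cosh_sq'] at hg
  have hs : 0 ≤ Real.sinh (a.hdist b) * Real.sinh (b.hdist c) :=
    mul_nonneg (Real.sinh_nonneg_iff.2 h0) (Real.sinh_nonneg_iff.2 h1)
  have := abs_le_of_sq_le_sq' (b := Real.sinh (a.hdist b) * Real.sinh (b.hdist c))
    (hg.trans_eq (by ring)) hs
  linarith [this.1]

/-- This is the Minkowski form in the null coordinates `(1/t, x/t, y/t, |p|²/t)` of the hyperboloid,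
where `z = x + iy`. -/
theorem coshDist_eq_null (p q : HypSpace) : coshDist p q =
    (1 / p.t * ((q.z.re ^ 2 + q.z.im ^ 2 + q.t ^ 2) / q.t)
      + 1 / q.t * ((p.z.re ^ 2 + p.z.im ^ 2 + p.t ^ 2) / p.t)) / 2
    - p.z.re / p.t * (q.z.re / q.t) - p.z.im / p.t * (q.z.im / q.t) := by
  have hp := p.t_pos.ne'
  have hq := q.t_pos.ne'
  rw [coshDist_eq]
  field_simp
  ring

/-- In the hyperboloid model, the midpoint `m` of `a` and `b` is proportional to `a + b`. -/
theorem coshDist_midpoint {a b m : HypSpace} {h : ℝ} (ham : a.hdist m = h) (hmb : m.hdist b = h)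
    (hab : a.hdist b = 2 * h) (o : HypSpace) :
    coshDist o a + coshDist o b = 2 * Real.cosh h * coshDist o m := by
  obtain ⟨l, hl⟩ : ∃ l : HypSpace → ℝ, ∀ p, 1 / p.t = l p := ⟨_, fun _ => rfl⟩
  obtain ⟨x, hx⟩ : ∃ x : HypSpace → ℝ, ∀ p, p.z.re / p.t = x p := ⟨_, fun _ => rfl⟩
  obtain ⟨y, hy⟩ : ∃ y : HypSpace → ℝ, ∀ p, p.z.im / p.t = y p := ⟨_, fun _ => rfl⟩
  obtain ⟨N, hN⟩ : ∃ N : HypSpace → ℝ, ∀ p, (p.z.re ^ 2 + p.z.im ^ 2 + p.t ^ 2) / p.t = N p :=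
    ⟨_, fun _ => rfl⟩
  have hcd : ∀ p q, coshDist p q = (l p * N q + l q * N p) / 2 - x p * x q - y p * y q := by
    intro p q
    rw [coshDist_eq_null, hl, hl, hx, hx, hy, hy, hN, hN]
  have hunit : ∀ p, l p * N p = 1 + x p ^ 2 + y p ^ 2 := by
    intro p
    have h1 := hcd p p
    rw [← cosh_hdist, hdist_self, Real.cosh_zero] at h1
    linear_combination -h1
  have e1 := cosh_hdist a m
  have e2 := cosh_hdist m b
  have e3 := cosh_hdist a b
  rw [ham, hcd] at e1
  rw [hmb, hcd] at e2
  rw [hab, Real.cosh_two_mul, Real.sinh_sq, hcd] at e3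
  set k := Real.cosh h
  obtain ⟨A, hA⟩ : ∃ A, A = l a + l b - 2 * k * l m := ⟨_, rfl⟩
  obtain ⟨X, hX⟩ : ∃ X, X = x a + x b - 2 * k * x m := ⟨_, rfl⟩
  obtain ⟨Y, hY⟩ : ∃ Y, Y = y a + y b - 2 * k * y m := ⟨_, rfl⟩
  obtain ⟨B, hB⟩ : ∃ B, B = N a + N b - 2 * k * N m := ⟨_, rfl⟩
  -- The vector `a + b - 2 cosh h · m` is null and orthogonal to the timelike vector `m`, hence
  -- zero.
  have hnull : A * B = X ^ 2 + Y ^ 2 := by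
    rw [hA, hB, hX, hY]
    linear_combination hunit a + hunit b + 4 * k ^ 2 * hunit m + 4 * k * e1 + 4 * k * e2 - 2 * e3
  have horth : A * N m + B * l m = 2 * (X * x m + Y * y m) := by
    rw [hA, hB, hX, hY]
    linear_combination -2 * e1 - 2 * e2 - 4 * k * hunit m
  have hsum : A ^ 2 + (A * x m - l m * X) ^ 2 + (A * y m - l m * Y) ^ 2 = 0 := by
    linear_combination A * l m * horth - A ^ 2 * hunit m - l m ^ 2 * hnull
  have hlm : l m ≠ 0 := by
    rw [← hl]
    have := m.t_pos.ne'
    positivity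
  have hA0 : A = 0 := by
    have : A ^ 2 = 0 := le_antisymm (by
      linarith [sq_nonneg (A * x m - l m * X), sq_nonneg (A * y m - l m * Y)]) (sq_nonneg A)
    simpa using this
  have hXY : X ^ 2 + Y ^ 2 = 0 := by rw [← hnull, hA0, zero_mul]
  have hX0 : X = 0 := by
    have : X ^ 2 = 0 := le_antisymm (by linarith [sq_nonneg Y]) (sq_nonneg X)
    simpa using this
  have hY0 : Y = 0 := by
    have : Y ^ 2 = 0 := le_antisymm (by linarith [sq_nonneg X]) (sq_nonneg Y)
    simpa using this
  have hB0 : B = 0 := by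
    rw [hA0, hX0, hY0] at horth
    simpa [hlm] using horth
  rw [hcd, hcd, hcd]
  rw [hA0] at hA
  rw [hX0] at hX
  rw [hY0] at hY
  rw [hB0] at hB
  linear_combination -(N o / 2) * hA - l o / 2 * hB + x o * hX + y o * hY

/-- A point of the hyperboloid, in null coordinates, gives a point of the upper half-space. -/
noncomputable def ofNull (A X Y : ℝ) (hA : 0 < A) : HypSpace :=
  ⟨⟨X / A, Y / A⟩, 1 / A, by positivity⟩

theorem coshDist_ofNull {A X Y A' X' Y' B B' : ℝ} (hA : 0 < A) (hA' : 0 < A')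
    (h : A * B - X ^ 2 - Y ^ 2 = 1) (h' : A' * B' - X' ^ 2 - Y' ^ 2 = 1) :
    coshDist (ofNull A X Y hA) (ofNull A' X' Y' hA') =
      (A * B' + A' * B) / 2 - X * X' - Y * Y' := by
  have hB : B = (1 + X ^ 2 + Y ^ 2) / A := by
    field_simp
    linarith
  have hB' : B' = (1 + X' ^ 2 + Y' ^ 2) / A' := by
    field_simp
    linarith
  rw [coshDist_eq, hB, hB']
  simp only [ofNull]
  field_simp
  ring

/-! ### Geodesics and local geodesics -/

theorem exists_geodesic (a b : HypSpace) (hab : 0 < a.hdist b) :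
    ∃ P : ℝ → HypSpace, P 0 = a ∧ P (a.hdist b) = b ∧
      ∀ s ∈ Set.Icc 0 (a.hdist b), ∀ s' ∈ Set.Icc 0 (a.hdist b),
        (P s).hdist (P s') = |s - s'| := by
  have ha := a.t_pos
  have hb := b.t_pos
  set D := a.hdist b with hD
  have hsD : 0 < Real.sinh D := Real.sinh_pos_iff.2 hab
  have e := cosh_hdist a b
  rw [← hD, coshDist_eq] at e
  -- On the hyperboloid the unit-speed geodesic is `α s · a + β s · b`.
  obtain ⟨α, hα⟩ : ∃ α : ℝ → ℝ, ∀ s, α s = Real.sinh (D - s) / Real.sinh D := ⟨_, fun _ => rfl⟩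
  obtain ⟨β, hβ⟩ : ∃ β : ℝ → ℝ, ∀ s, β s = Real.sinh s / Real.sinh D := ⟨_, fun _ => rfl⟩
  obtain ⟨N, hN⟩ : ∃ N : HypSpace → ℝ, ∀ p, N p = (p.z.re ^ 2 + p.z.im ^ 2 + p.t ^ 2) / p.t :=
    ⟨_, fun _ => rfl⟩
  have hpos : ∀ s ∈ Set.Icc 0 D, 0 < α s / a.t + β s / b.t := by
    rintro s ⟨h0, h1⟩
    rcases h0.eq_or_lt with rfl | h0
    · have : α 0 = 1 := by rw [hα, sub_zero, div_self hsD.ne']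
      have h2 : β 0 = 0 := by rw [hβ]; simp
      rw [this, h2]
      simp [ha]
    · have h2 : 0 ≤ α s := by
        rw [hα]
        exact div_nonneg (Real.sinh_nonneg_iff.2 (by linarith)) hsD.le
      have h3 : 0 < β s := by
        rw [hβ]
        exact div_pos (Real.sinh_pos_iff.2 h0) hsD
      positivity
  have hform : ∀ s s', α s * α s' + β s * β s' + (α s * β s' + β s * α s') * Real.cosh D
      = Real.cosh (s - s') := by
    intro s s'
    rw [hα, hα, hβ, hβ]
    have h3 : Real.cosh (s - s') = Real.cosh s * Real.cosh s' - Real.sinh s * Real.sinh s' :=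
      Real.cosh_sub _ _
    rw [h3, Real.sinh_sub, Real.sinh_sub]
    field_simp
    have h4 := Real.cosh_sq' D
    linear_combination -(Real.sinh s * Real.sinh s') * h4
  have hbil : ∀ s s', ((α s / a.t + β s / b.t) * (α s' * N a + β s' * N b)
      + (α s' / a.t + β s' / b.t) * (α s * N a + β s * N b)) / 2
      - (α s * (a.z.re / a.t) + β s * (b.z.re / b.t)) *
        (α s' * (a.z.re / a.t) + β s' * (b.z.re / b.t))
      - (α s * (a.z.im / a.t) + β s * (b.z.im / b.t)) *
        (α s' * (a.z.im / a.t) + β s' * (b.z.im / b.t)) = Real.cosh (s - s') := by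
    intro s s'
    rw [← hform, e, hN, hN]
    field_simp
    ring
  -- The fallback value `a` is never taken on `[0, D]`, by `hpos`.
  refine ⟨fun s => if h : 0 < α s / a.t + β s / b.t then ofNull (α s / a.t + β s / b.t)
    (α s * (a.z.re / a.t) + β s * (b.z.re / b.t)) (α s * (a.z.im / a.t) + β s * (b.z.im / b.t)) h
    else a, ?_, ?_, ?_⟩
  · dsimp only
    rw [dif_pos (hpos 0 ⟨le_rfl, hab.le⟩)]
    have h1 : α 0 = 1 := by rw [hα, sub_zero, div_self hsD.ne']
    have h2 : β 0 = 0 := by rw [hβ]; simp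
    ext1
    · apply Complex.ext
      · simp [ofNull, h1, h2, ha.ne']
      · simp [ofNull, h1, h2, ha.ne']
    · simp [ofNull, h1, h2]
  · dsimp only
    rw [dif_pos (hpos D ⟨hab.le, le_rfl⟩)]
    have h1 : α D = 0 := by rw [hα]; simp
    have h2 : β D = 1 := by rw [hβ, div_self hsD.ne']
    ext1
    · apply Complex.ext
      · simp [ofNull, h1, h2, hb.ne']
      · simp [ofNull, h1, h2, hb.ne']
    · simp [ofNull, h1, h2]
  · intro s hs s' hs'
    dsimp only
    rw [dif_pos (hpos s hs), dif_pos (hpos s' hs')]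
    apply hdist_eq_of_cosh (abs_nonneg _)
    rw [Real.cosh_abs, ← hbil, coshDist_ofNull (B := α s * N a + β s * N b)
      (B' := α s' * N a + β s' * N b)]
    · have := hbil s s
      rw [sub_self, Real.cosh_zero] at this
      linear_combination this
    · have := hbil s' s'
      rw [sub_self, Real.cosh_zero] at this
      linear_combination this

/-- A path in hyperbolic space that is locally a unit-speed geodesic does not close up. -/
theorem local_geodesic_not_closed {D : ℝ} (hD : 0 < D) (σ : ℝ → HypSpace)
    (hσ : ∀ s ∈ Set.Icc 0 D, ∃ η > 0, ∀ s₁ ∈ Set.Icc 0 D, ∀ s₂ ∈ Set.Icc 0 D,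
      |s₁ - s| < η → |s₂ - s| < η → (σ s₁).hdist (σ s₂) = |s₁ - s₂|) :
    σ 0 ≠ σ D := by
  intro hclosed
  set u : ℝ → ℝ := fun s => (σ 0).hdist (σ s) with hu
  have hcont : ContinuousOn u (Set.Icc 0 D) := by
    intro s hs
    obtain ⟨η, hη, H⟩ := hσ s hs
    rw [Metric.continuousWithinAt_iff]
    intro e he
    refine ⟨min η e, lt_min hη he, fun x hx hxs => ?_⟩
    rw [Real.dist_eq] at hxs ⊢
    have h1 := H x hx s hs (hxs.trans_le (min_le_left _ _)) (by simpa using hη)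
    have h2 := hdist_triangle (σ 0) (σ s) (σ x)
    have h3 := hdist_triangle (σ 0) (σ x) (σ s)
    rw [hdist_comm (σ s), h1] at h2
    rw [h1] at h3
    have h4 := hxs.trans_le (min_le_right _ _)
    rw [abs_lt]
    simp only [hu]
    constructor <;> linarith
  -- The midpoint formula gives `cosh u(s-h) + cosh u(s+h) = 2 cosh h cosh u(s) > 2 cosh u(s)`, so
  -- the distance from `σ 0` has no interior maximum.
  have hinterior : ∀ s ∈ Set.Ioo 0 D, ∃ x ∈ Set.Icc 0 D, u s < u x := by
    rintro s ⟨hs0, hsD⟩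
    obtain ⟨η, hη, H⟩ := hσ s ⟨hs0.le, hsD.le⟩
    obtain ⟨h, hh0, hh⟩ := exists_between (lt_min hη (lt_min hs0 (sub_pos.2 hsD)))
    simp only [lt_min_iff] at hh
    obtain ⟨hh1, hh2, hh3⟩ := hh
    have m0 : s ∈ Set.Icc 0 D := ⟨hs0.le, hsD.le⟩
    have m1 : s - h ∈ Set.Icc 0 D := ⟨by linarith, by linarith⟩
    have m2 : s + h ∈ Set.Icc 0 D := ⟨by linarith, by linarith⟩
    have n0 : |s - s| < η := by simpa using hη
    have n1 : |s - h - s| < η := by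
      rw [abs_lt]
      constructor <;> linarith
    have n2 : |s + h - s| < η := by
      rw [abs_lt]
      constructor <;> linarith
    have e1 : (σ (s - h)).hdist (σ s) = h := by
      rw [H _ m1 _ m0 n1 n0, show s - h - s = -h by ring, abs_neg, abs_of_pos hh0]
    have e2 : (σ s).hdist (σ (s + h)) = h := by
      rw [H _ m0 _ m2 n0 n2, show s - (s + h) = -h by ring, abs_neg, abs_of_pos hh0]
    have e3 : (σ (s - h)).hdist (σ (s + h)) = 2 * h := by
      rw [H _ m1 _ m2 n1 n2, show s - h - (s + h) = -(2 * h) by ring, abs_neg,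
        abs_of_pos (by linarith)]
    have key := coshDist_midpoint e1 e2 e3 (σ 0)
    by_contra! hcon
    have c1 := hcon _ m1
    have c2 := hcon _ m2
    have mono : ∀ {x}, u x ≤ u s → coshDist (σ 0) (σ x) ≤ coshDist (σ 0) (σ s) := by
      intro x hx
      rw [← cosh_hdist, ← cosh_hdist, Real.cosh_le_cosh, abs_of_nonneg (hdist_nonneg _ _),
        abs_of_nonneg (hdist_nonneg _ _)]
      exact hx
    have k1 := mono c1
    have k2 := mono c2
    have k3 := one_le_coshDist (σ 0) (σ s)
    have k4 : 1 < Real.cosh h := Real.one_lt_cosh.2 hh0.ne'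
    nlinarith
  obtain ⟨s, hs, hmax⟩ := isCompact_Icc.exists_isMaxOn (Set.nonempty_Icc.2 hD.le) hcont
  have hmid : D / 2 ∈ Set.Ioo 0 D := ⟨by linarith, by linarith⟩
  by_cases hs' : s ∈ Set.Ioo 0 D
  · obtain ⟨x, hx, hlt⟩ := hinterior s hs'
    exact absurd (hmax hx) (not_le.2 hlt)
  -- A maximum at an endpoint of a closed path would be `0`, but some value strictly exceeds `u (D /
  -- 2) ≥ 0`.
  · have hs0 : u s = 0 := by
      have h0 : u 0 = 0 := hdist_self _
      have hD0 : u D = 0 := by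
        simp only [hu]
        rw [← hclosed, hdist_self]
      rcases hs.1.eq_or_lt with h | h
      · rw [← h, h0]
      · rcases hs.2.eq_or_lt with h' | h'
        · rw [h', hD0]
        · exact absurd ⟨h, h'⟩ hs'
    obtain ⟨x, hx, hlt⟩ := hinterior _ hmid
    have h1 : u x ≤ u s := hmax hx
    have h2 : 0 ≤ u (D / 2) := hdist_nonneg _ _
    linarith

end HypSpace

/-! ### Displacement of the powers of the isometry -/

namespace HypSpace

theorem vadd_z (v : ℂ) (p : HypSpace) : (v +ᵥ p).z = Complex.exp v * p.z := rfl

theorem vadd_t (v : ℂ) (p : HypSpace) : (v +ᵥ p).t = Real.exp v.re * p.t := rfl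

theorem hdist_vadd (v : ℂ) (p q : HypSpace) : (v +ᵥ p).hdist (v +ᵥ q) = p.hdist q := by
  apply hdist_eq_of_cosh (hdist_nonneg p q)
  have := p.t_pos.ne'
  have := q.t_pos.ne'
  rw [cosh_hdist, coshDist, coshDist, vadd_z, vadd_z, vadd_t, vadd_t, ← mul_sub, norm_mul,
    Complex.norm_exp]
  field_simp

/-- The hyperbolic cosine of the displacement of the `k`-th power of the isometry of complex
length `w`, at the points whose distance from the axis has `sinh² = S`. -/
noncomputable def coshDisp (w : ℂ) (k : ℕ) (S : ℝ) : ℝ :=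
  Real.cosh (k * w.re) + (Real.cosh (k * w.re) - Real.cos (k * w.im)) * S

theorem coshDist_vadd_self (v : ℂ) (p : HypSpace) : coshDist p (v +ᵥ p) =
    Real.cosh v.re + (Real.cosh v.re - Real.cos v.im) * (‖p.z‖ / p.t) ^ 2 := by
  have hp := p.t_pos.ne'
  have he := (Real.exp_pos v.re).ne'
  have hc : Real.cosh v.re = (Real.exp v.re ^ 2 + 1) / (2 * Real.exp v.re) := by
    rw [Real.cosh_eq, Real.exp_neg]
    field_simp
  have hn : ‖p.z - Complex.exp v * p.z‖ ^ 2 =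
      (1 - 2 * Real.exp v.re * Real.cos v.im + Real.exp v.re ^ 2) * ‖p.z‖ ^ 2 := by
    rw [show p.z - Complex.exp v * p.z = (1 - Complex.exp v) * p.z by ring, norm_mul, mul_pow,
      Complex.sq_norm (1 - _), Complex.normSq_apply, Complex.sub_re, Complex.sub_im,
      Complex.exp_re, Complex.exp_im, Complex.one_re, Complex.one_im]
    congr 1
    linear_combination Real.exp v.re ^ 2 * Real.sin_sq_add_cos_sq v.im
  rw [coshDist, vadd_z, vadd_t, hn, hc]
  field_simp
  ring

theorem coshDist_zsmul_vadd (w : ℂ) (k : ℤ) (p : HypSpace) :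
    coshDist p ((k • w) +ᵥ p) = coshDisp w k.natAbs ((‖p.z‖ / p.t) ^ 2) := by
  rw [coshDist_vadd_self, coshDisp]
  have hre : (k • w).re = k * w.re := by simp
  have him : (k • w).im = k * w.im := by simp
  rw [hre, him]
  rcases Int.natAbs_eq k with h | h
  · have : (k : ℝ) = (k.natAbs : ℝ) := by
      conv_lhs => rw [h]
      exact Int.cast_natCast _
    rw [this]
  · have : (k : ℝ) = -(k.natAbs : ℝ) := by
      conv_lhs => rw [h]
      rw [Int.cast_neg, Int.cast_natCast]
    rw [this, neg_mul, neg_mul, Real.cosh_neg, Real.cos_neg]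

theorem cosh_re_le_cosh_mul {w : ℂ} (hw : 0 < w.re) {k : ℕ} (hk : 0 < k) :
    Real.cosh w.re ≤ Real.cosh (k * w.re) := by
  have : (1 : ℝ) ≤ k := by exact_mod_cast hk
  rw [Real.cosh_le_cosh, abs_of_pos hw, abs_of_nonneg (by positivity)]
  nlinarith

/-- The slope bound `cosh λ - 1` does not depend on `k`, so the infimum over all powers also grows
strictly with `S`. -/
theorem coshDisp_add_le {w : ℂ} (hw : 0 < w.re) {k : ℕ} (hk : 0 < k) {S S' : ℝ} (h : S ≤ S') :
    coshDisp w k S + (Real.cosh w.re - 1) * (S' - S) ≤ coshDisp w k S' := by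
  have h1 := cosh_re_le_cosh_mul hw hk
  have h2 := Real.cos_le_one (k * w.im)
  unfold coshDisp
  nlinarith [mul_nonneg (sub_nonneg.2 h1) (sub_nonneg.2 h), mul_nonneg (sub_nonneg.2 h2)
    (sub_nonneg.2 h)]

theorem coshDisp_strictMono {w : ℂ} (hw : 0 < w.re) {k : ℕ} (hk : 0 < k) :
    StrictMono (coshDisp w k) := by
  intro S S' h
  have h1 := coshDisp_add_le hw hk h.le
  have h2 := Real.one_lt_cosh.2 hw.ne'
  nlinarith [mul_pos (sub_pos.2 h2) (sub_pos.2 h)]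

theorem cosh_le_coshDisp (w : ℂ) (k : ℕ) {S : ℝ} (hS : 0 ≤ S) :
    Real.cosh (k * w.re) ≤ coshDisp w k S := by
  have h1 := Real.one_le_cosh (k * w.re)
  have h2 := Real.cos_le_one (k * w.im)
  unfold coshDisp
  nlinarith [mul_nonneg (sub_nonneg.2 (h2.trans h1)) hS]

theorem re_le_hdist_vadd {w : ℂ} (hw : 0 < w.re) {k : ℤ} (hk : k ≠ 0) (p : HypSpace) :
    w.re ≤ p.hdist ((k • w) +ᵥ p) := by
  rw [le_hdist_iff hw.le, coshDist_zsmul_vadd]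
  exact (cosh_re_le_cosh_mul hw (Int.natAbs_pos.2 hk)).trans
    (cosh_le_coshDisp w _ (by positivity))

/-- `sinh²` of the radius of the `s`-tube. -/
theorem exists_min_coshDisp_eq {w : ℂ} (hw : 0 < w.re) {s : ℝ} (hs : w.re ≤ s) :
    ∃ S : ℝ, 0 ≤ S ∧ (∀ k : ℕ, 0 < k → Real.cosh s ≤ coshDisp w k S) ∧
      ∃ k : ℕ, 0 < k ∧ coshDisp w k S = Real.cosh s := by
  -- Powers beyond `K` translate by at least `s` already on the axis, so only finitely many matter.
  -- Among these take the largest root `f k` of `coshDisp w k S = cosh s`; it is nonnegative because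
  -- `f 1` is, by `λ ≤ s`.
  obtain ⟨K, hK⟩ := exists_nat_ge (s / w.re)
  rw [div_le_iff₀ hw] at hK
  have hK0 : 1 ≤ K := by
    rcases Nat.eq_zero_or_pos K with rfl | h
    · simp at hK
      linarith
    · exact h
  have hpos : ∀ k : ℕ, 0 < k → 0 < Real.cosh (k * w.re) - Real.cos (k * w.im) := fun k hk => by
    have h1 := Real.one_lt_cosh.2 hw.ne'
    have h2 := cosh_re_le_cosh_mul hw hk
    have h3 := Real.cos_le_one (k * w.im)
    linarith
  obtain ⟨f, hf⟩ : ∃ f : ℕ → ℝ, ∀ k, f k = (Real.cosh s - Real.cosh (k * w.re)) /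
      (Real.cosh (k * w.re) - Real.cos (k * w.im)) := ⟨_, fun _ => rfl⟩
  have hfF : ∀ k : ℕ, 0 < k → coshDisp w k (f k) = Real.cosh s := fun k hk => by
    have := (hpos k hk).ne'
    rw [hf, coshDisp, mul_div_cancel₀ _ this]
    ring
  obtain ⟨k₀, hk₀, hmax⟩ := Finset.exists_max_image (Finset.Icc 1 K) f ⟨1, by simp [hK0]⟩
  have hS0 : 0 ≤ f k₀ := by
    refine le_trans ?_ (hmax 1 (by simp [hK0]))
    rw [hf]
    refine div_nonneg ?_ (hpos 1 one_pos).le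
    rw [sub_nonneg, Real.cosh_le_cosh, Nat.cast_one, one_mul, abs_of_pos hw,
      abs_of_pos (hw.trans_le hs)]
    exact hs
  have hk₀' : 0 < k₀ := (Finset.mem_Icc.1 hk₀).1
  refine ⟨f k₀, hS0, fun k hk => ?_, k₀, hk₀', hfF _ hk₀'⟩
  by_cases hkK : k ≤ K
  · rw [← hfF k hk]
    exact (coshDisp_strictMono hw hk).monotone (hmax k (Finset.mem_Icc.2 ⟨hk, hkK⟩))
  · refine le_trans ?_ (cosh_le_coshDisp w k hS0)
    have : (K : ℝ) ≤ k := by exact_mod_cast (not_le.1 hkK).le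
    rw [Real.cosh_le_cosh, abs_of_pos (hw.trans_le hs), abs_of_nonneg (by positivity)]
    nlinarith

end HypSpace

/-! ### Embedded balls, injectivity radius and tubes of the quotient -/

namespace SolidTorus

open HypSpace

theorem proj_eq_proj_iff {w : ℂ} {p q : HypSpace} :
    proj w p = proj w q ↔ ∃ k : ℤ, (k • w) +ᵥ q = p := by
  unfold proj
  rw [Quotient.eq]
  rw [AddAction.orbitRel_apply, AddAction.mem_orbit_iff]
  constructor
  · rintro ⟨⟨_, k, rfl⟩, h⟩
    exact ⟨k, h⟩
  · rintro ⟨k, h⟩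
    exact ⟨⟨k • w, k, rfl⟩, h⟩

theorem proj_zsmul_vadd (w : ℂ) (k : ℤ) (p : HypSpace) : proj w ((k • w) +ᵥ p) = proj w p :=
  proj_eq_proj_iff.2 ⟨k, rfl⟩

theorem exists_proj_eq {w : ℂ} (x : SolidTorus w) : ∃ p, proj w p = x :=
  Quotient.exists_rep x

theorem bddBelow_hdist_lifts {w : ℂ} (x y : SolidTorus w) :
    BddBelow {d : ℝ | ∃ p q : HypSpace, proj w p = x ∧ proj w q = y ∧ d = p.hdist q} :=
  ⟨0, by rintro _ ⟨p, q, -, -, rfl⟩; exact hdist_nonneg p q⟩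

theorem qdist_proj_le (w : ℂ) (p q : HypSpace) : qdist (proj w p) (proj w q) ≤ p.hdist q :=
  csInf_le (bddBelow_hdist_lifts _ _) ⟨p, q, rfl, rfl, rfl⟩

theorem qdist_proj_lt_iff {w : ℂ} {p : HypSpace} {y : SolidTorus w} {r : ℝ} :
    qdist (proj w p) y < r ↔ ∃ q, proj w q = y ∧ p.hdist q < r := by
  constructor
  · intro h
    obtain ⟨q₀, hq₀⟩ := exists_proj_eq y
    obtain ⟨_, ⟨p', q, hp', hq, rfl⟩, hlt⟩ :=
      (csInf_lt_iff (bddBelow_hdist_lifts _ _) ⟨_, p, q₀, rfl, hq₀, rfl⟩).1 h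
    obtain ⟨k, rfl⟩ := proj_eq_proj_iff.1 hp'.symm
    exact ⟨(k • w) +ᵥ q, by rw [proj_zsmul_vadd, hq], by rwa [hdist_vadd]⟩
  · rintro ⟨q, rfl, h⟩
    exact (qdist_proj_le w p q).trans_lt h

/-- Distinct lifts of a point are at least `λ` apart, so a lift nearer to `p` than `q` would
contradict the triangle inequality. Thus the covering is a local isometry at a uniform scale. -/
theorem qdist_proj_eq {w : ℂ} (hw : 0 < w.re) {p q : HypSpace} (h : p.hdist q ≤ w.re / 2) :
    qdist (proj w p) (proj w q) = p.hdist q := by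
  refine le_antisymm (qdist_proj_le w p q) (not_lt.1 fun hlt => ?_)
  obtain ⟨q', hq', hlt'⟩ := qdist_proj_lt_iff.1 hlt
  obtain ⟨k, rfl⟩ := proj_eq_proj_iff.1 hq'
  have hk : k ≠ 0 := by
    rintro rfl
    simp at hlt'
  have h1 := re_le_hdist_vadd hw hk q
  have h2 := hdist_triangle q p ((k • w) +ᵥ q)
  rw [hdist_comm q p] at h2
  linarith

/-- The covering projection itself is the isometry: two lifts of one point in the ball would give a
displacement of `p` below `2r`. -/
theorem isHyperbolicBall_of_le {w : ℂ} (hw : 0 < w.re) {p : HypSpace} {r : ℝ}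
    (h : ∀ k : ℤ, k ≠ 0 → 2 * r ≤ p.hdist ((k • w) +ᵥ p)) : IsHyperbolicBall (proj w p) r := by
  have hinj : ∀ q, ∀ k : ℤ, p.hdist q < r → p.hdist ((k • w) +ᵥ q) < r → k = 0 := by
    intro q k h1 h2
    by_contra hk
    have h3 := h k hk
    have h4 := hdist_triangle p ((k • w) +ᵥ q) ((k • w) +ᵥ p)
    rw [hdist_vadd, hdist_comm q p] at h4
    linarith
  refine ⟨p, proj w, rfl, ⟨?_, ?_, ?_⟩, ?_, ?_⟩
  · intro q hq
    exact (qdist_proj_le w p q).trans_lt hq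
  · intro q hq q' hq' heq
    obtain ⟨k, rfl⟩ := proj_eq_proj_iff.1 heq
    rw [hinj q' k hq' hq, zero_smul, zero_vadd]
  · intro y hy
    obtain ⟨q, hq, hlt⟩ := qdist_proj_lt_iff.1 hy
    exact ⟨q, hlt, hq⟩
  · intro a _
    refine ⟨w.re / 4, by positivity, fun q q' _ _ h1 h2 => qdist_proj_eq hw ?_⟩
    have := hdist_triangle q a q'
    rw [hdist_comm q a] at this
    linarith
  · intro a ha
    -- The term `r - p.hdist a` keeps the lift nearest to `a` inside the ball, where lifts are
    -- unique.
    refine ⟨min (w.re / 4) (r - p.hdist a), lt_min (by positivity) (sub_pos.2 ha),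
      fun q q' hq hq' h1 h2 => ?_⟩
    have close : ∀ b, p.hdist b < r →
        qdist (proj w a) (proj w b) < min (w.re / 4) (r - p.hdist a) → a.hdist b < w.re / 4 := by
      intro b hb hab
      obtain ⟨b', hb', hlt⟩ := qdist_proj_lt_iff.1 hab
      obtain ⟨k, rfl⟩ := proj_eq_proj_iff.1 hb'
      have h3 := hdist_triangle p a ((k • w) +ᵥ b)
      have h4 := hlt.trans_le (min_le_right _ _)
      rw [hinj b k hb (by linarith), zero_smul, zero_vadd] at hlt
      exact hlt.trans_le (min_le_left _ _)
    have h3 := close q hq h1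
    have h4 := close q' hq' h2
    have := hdist_triangle q a q'
    rw [hdist_comm q a] at this
    exact (qdist_proj_eq hw (by linarith)).symm

/-- Otherwise the geodesic from `p` to its translate, shorter than `2r`, projects to a loop inside
the ball, each of its points being within `r` of an end. Pulled back by `f`, it is a local geodesic
of `ℍ³` that injectivity of `f` forces to close up. -/
theorem le_hdist_of_isHyperbolicBall {w : ℂ} (hw : 0 < w.re) {p : HypSpace} {r : ℝ}
    (h : IsHyperbolicBall (proj w p) r) {k : ℤ} (hk : k ≠ 0) :
    2 * r ≤ p.hdist ((k • w) +ᵥ p) := by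
  obtain ⟨c, f, hfc, hbij, -, hloc⟩ := h
  by_contra! hlt
  have hD : 0 < p.hdist ((k • w) +ᵥ p) := hw.trans_le (re_le_hdist_vadd hw hk p)
  obtain ⟨P, hP0, hPD, hP⟩ := exists_geodesic p _ hD
  set D := p.hdist ((k • w) +ᵥ p)
  have m0 : (0 : ℝ) ∈ Set.Icc 0 D := ⟨le_rfl, hD.le⟩
  have mD : D ∈ Set.Icc 0 D := ⟨hD.le, le_rfl⟩
  have hball : ∀ s ∈ Set.Icc 0 D, ∃ q, c.hdist q < r ∧ f q = proj w (P s) := by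
    intro s hs
    refine hbij.surjOn (show qdist (proj w p) (proj w (P s)) < r from ?_)
    rcases lt_or_ge s r with h | h
    · refine (qdist_proj_le w _ _).trans_lt ?_
      rwa [← hP0, hP 0 m0 s hs, zero_sub, abs_neg, abs_of_nonneg hs.1]
    · rw [← proj_zsmul_vadd w k p]
      refine (qdist_proj_le w _ _).trans_lt ?_
      rw [← hPD, hP D mD s hs, abs_of_nonneg (sub_nonneg.2 hs.2)]
      linarith
  have : Nonempty HypSpace := ⟨p⟩
  choose! σ hσr hσ using hball
  have hcr : c.hdist c < r := by
    rw [hdist_self]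
    linarith
  refine local_geodesic_not_closed hD σ (fun s hs => ?_) ?_
  · obtain ⟨ρ, hρ, H⟩ := hloc (σ s) (hσr s hs)
    refine ⟨min ρ (w.re / 4), lt_min hρ (by positivity), fun s₁ hs₁ s₂ hs₂ h1 h2 => ?_⟩
    have close : ∀ t ∈ Set.Icc 0 D, |t - s| < min ρ (w.re / 4) →
        qdist (f (σ s)) (f (σ t)) < ρ := by
      intro t ht hts
      rw [hσ s hs, hσ t ht]
      refine (qdist_proj_le w _ _).trans_lt ?_
      rw [hP s hs t ht, abs_sub_comm]
      exact hts.trans_le (min_le_left _ _)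
    rw [H _ _ (hσr _ hs₁) (hσr _ hs₂) (close _ hs₁ h1) (close _ hs₂ h2), hσ _ hs₁, hσ _ hs₂,
      qdist_proj_eq hw, hP _ hs₁ _ hs₂]
    rw [hP _ hs₁ _ hs₂]
    have h3 := abs_sub_le s₁ s s₂
    rw [abs_sub_comm s s₂] at h3
    have h4 := h1.trans_le (min_le_right _ _)
    have h5 := h2.trans_le (min_le_right _ _)
    linarith
  · apply hbij.injOn (hσr 0 m0) (hσr D mD)
    rw [hσ 0 m0, hσ D mD, hP0, hPD, proj_zsmul_vadd]

theorem isHyperbolicBall_iff {w : ℂ} (hw : 0 < w.re) {p : HypSpace} {r : ℝ} (hr : 0 < r) :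
    IsHyperbolicBall (proj w p) r ↔
      ∀ k : ℕ, 0 < k → Real.cosh (2 * r) ≤ coshDisp w k ((‖p.z‖ / p.t) ^ 2) := by
  constructor
  · intro h k hk
    have := le_hdist_of_isHyperbolicBall hw h (k := k) (by exact_mod_cast hk.ne')
    rwa [le_hdist_iff (by positivity), coshDist_zsmul_vadd, Int.natAbs_natCast] at this
  · intro h
    refine isHyperbolicBall_of_le hw fun k hk => ?_
    rw [le_hdist_iff (by positivity), coshDist_zsmul_vadd]
    exact h _ (Int.natAbs_pos.2 hk)

theorem coreDist_proj (w : ℂ) (p : HypSpace) :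
    coreDist (proj w p) = Real.arsinh (‖p.z‖ / p.t) := by
  have hp := p.t_pos
  have hR : 0 ≤ Real.arsinh (‖p.z‖ / p.t) := Real.arsinh_nonneg_iff.2 (by positivity)
  have hcosh : Real.cosh (Real.arsinh (‖p.z‖ / p.t)) = √(‖p.z‖ ^ 2 + p.t ^ 2) / p.t := by
    rw [Real.cosh_arsinh, show 1 + (‖p.z‖ / p.t) ^ 2 = (‖p.z‖ ^ 2 + p.t ^ 2) / p.t ^ 2 by
      field_simp; ring, Real.sqrt_div (by positivity), Real.sqrt_sq hp.le]
  have hpos : 0 < √(‖p.z‖ ^ 2 + p.t ^ 2) := by positivity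
  have hsq : √(‖p.z‖ ^ 2 + p.t ^ 2) ^ 2 = ‖p.z‖ ^ 2 + p.t ^ 2 := Real.sq_sqrt (by positivity)
  have hlower : ∀ y ∈ core w, Real.arsinh (‖p.z‖ / p.t) ≤ qdist (proj w p) y := by
    rintro _ ⟨q, hq, rfl⟩
    by_contra! hlt
    obtain ⟨q', hq', hlt'⟩ := qdist_proj_lt_iff.1 hlt
    obtain ⟨k, rfl⟩ := proj_eq_proj_iff.1 hq'
    refine absurd hlt' (not_lt.2 ?_)
    rw [le_hdist_iff hR, hcosh, coshDist, vadd_z, hq, mul_zero, sub_zero]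
    set t := ((k • w) +ᵥ q).t
    have ht : 0 < t := ((k • w) +ᵥ q).t_pos
    rw [show 1 + (‖p.z‖ ^ 2 + (p.t - t) ^ 2) / (2 * p.t * t) =
      ((‖p.z‖ ^ 2 + p.t ^ 2) + t ^ 2) / (2 * t) / p.t by field_simp; ring]
    refine div_le_div_of_nonneg_right ?_ hp.le
    rw [le_div_iff₀ (by positivity)]
    nlinarith [sq_nonneg (√(‖p.z‖ ^ 2 + p.t ^ 2) - t)]
  -- The foot of the perpendicular to the axis lies at the same Euclidean distance from the origin
  -- as `p`.
  set q : HypSpace := ⟨0, √(‖p.z‖ ^ 2 + p.t ^ 2), hpos⟩ with hq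
  have hqd : p.hdist q = Real.arsinh (‖p.z‖ / p.t) := by
    apply hdist_eq_of_cosh hR
    rw [hcosh, coshDist]
    simp only [hq, sub_zero]
    field_simp
    linear_combination -hsq
  have hqc : proj w q ∈ core w := ⟨q, rfl, rfl⟩
  unfold coreDist
  apply le_antisymm
  · refine le_trans (b := qdist (proj w p) (proj w q)) (csInf_le ?_ ⟨_, hqc, rfl⟩)
      ((qdist_proj_le w p q).trans_eq hqd)
    refine ⟨Real.arsinh (‖p.z‖ / p.t), ?_⟩
    rintro _ ⟨y, hy, rfl⟩
    exact hlower y hy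
  · refine le_csInf ⟨_, _, hqc, rfl⟩ ?_
    rintro _ ⟨y, hy, rfl⟩
    exact hlower y hy

/-- Inside radius `arsinh √S` the minimizing power `k₀` moves points by less than `s`; outside, the
uniform slope bound makes every power move them by more than `s` with a common margin. -/
theorem isTubeRadius_of_min {w : ℂ} (hw : 0 < w.re) {s S : ℝ} (hs : 0 < s) (hS : 0 ≤ S)
    (hle : ∀ k : ℕ, 0 < k → Real.cosh s ≤ coshDisp w k S)
    (heq : ∃ k : ℕ, 0 < k ∧ coshDisp w k S = Real.cosh s) :
    IsTubeRadius w s (Real.arsinh (√S)) := by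
  refine ⟨Real.arsinh_nonneg_iff.2 (Real.sqrt_nonneg _), ?_⟩
  obtain ⟨k₀, hk₀, he⟩ := heq
  ext x
  obtain ⟨p, rfl⟩ := exists_proj_eq x
  have hp := p.t_pos
  have hu : 0 ≤ ‖p.z‖ / p.t := by positivity
  have hinj : injrad (proj w p) = sSup {r : ℝ | 0 < r ∧ ∀ k : ℕ, 0 < k →
      Real.cosh (2 * r) ≤ coshDisp w k ((‖p.z‖ / p.t) ^ 2)} := by
    unfold injrad
    congr 1
    ext r
    exact and_congr_right fun hr => isHyperbolicBall_iff hw hr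
  simp only [Set.mem_ofPred_eq]
  rw [coreDist_proj, Real.arsinh_inj, hinj]
  have hcosh : ∀ {r a : ℝ}, 0 < r → 0 ≤ a → Real.cosh (2 * r) ≤ Real.cosh a → r ≤ a / 2 := by
    intro r a hr ha h
    rw [Real.cosh_le_cosh, abs_of_pos (by positivity), abs_of_nonneg ha] at h
    linarith
  rw [show ‖p.z‖ / p.t = √S ↔ (‖p.z‖ / p.t) ^ 2 = S by
    rw [eq_comm, Real.sqrt_eq_iff_eq_sq hS hu, eq_comm]]
  set U := (‖p.z‖ / p.t) ^ 2
  have hU : 0 ≤ U := sq_nonneg _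
  rcases lt_trichotomy U S with h | h | h
  · refine iff_of_false (ne_of_lt ?_) h.ne
    have h1 : coshDisp w k₀ U < Real.cosh s := he ▸ coshDisp_strictMono hw hk₀ h
    have h2 : 1 ≤ coshDisp w k₀ U := (Real.one_le_cosh _).trans (cosh_le_coshDisp w k₀ hU)
    have h3 : Real.arcosh (coshDisp w k₀ U) < s := by
      rw [← Real.arcosh_cosh hs.le]
      exact (Real.arcosh_lt_arcosh (by linarith) (by linarith)).2 h1
    refine lt_of_le_of_lt (b := Real.arcosh (coshDisp w k₀ U) / 2) (Real.sSup_le ?_ ?_)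
      (by linarith)
    · rintro r ⟨hr, H⟩
      apply hcosh hr (Real.arcosh_nonneg h2)
      rw [Real.cosh_arcosh h2]
      exact H k₀ hk₀
    · have := Real.arcosh_nonneg h2
      linarith
  · refine iff_of_true ?_ h
    rw [h]
    refine IsGreatest.csSup_eq ⟨⟨by positivity, fun k hk => ?_⟩, ?_⟩
    · rw [mul_div_cancel₀ _ two_ne_zero]
      exact hle k hk
    · rintro r ⟨hr, H⟩
      exact hcosh hr hs.le (he ▸ H k₀ hk₀)
  · refine iff_of_false (ne_of_gt ?_) h.ne'
    have h1 := Real.one_lt_cosh.2 hw.ne'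
    have h2 : 0 < (Real.cosh w.re - 1) * (U - S) := mul_pos (sub_pos.2 h1) (sub_pos.2 h)
    have h3 := Real.one_le_cosh s
    have h4 : s < Real.arcosh (Real.cosh s + (Real.cosh w.re - 1) * (U - S)) := by
      conv_lhs => rw [← Real.arcosh_cosh hs.le]
      exact (Real.arcosh_lt_arcosh (by linarith) (by linarith)).2 (by linarith)
    refine lt_of_lt_of_le (b := Real.arcosh (Real.cosh s + (Real.cosh w.re - 1) * (U - S)) / 2)
      (by linarith) (le_csSup ⟨Real.arcosh (coshDisp w 1 U) / 2, ?_⟩ ⟨by linarith, fun k hk => ?_⟩)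
    · rintro r ⟨hr, H⟩
      have h5 : 1 ≤ coshDisp w 1 U := (Real.one_le_cosh _).trans (cosh_le_coshDisp w 1 hU)
      apply hcosh hr (Real.arcosh_nonneg h5)
      rw [Real.cosh_arcosh h5]
      exact H 1 one_pos
    · rw [mul_div_cancel₀ _ two_ne_zero, Real.cosh_arcosh (by linarith)]
      linarith [hle k hk, coshDisp_add_le hw hk h.le]

end SolidTorus

/-! ### Numerical estimates -/

theorem one_add_sq_div_two_le_cosh {x : ℝ} (hx : 0 ≤ x) : 1 + x ^ 2 / 2 ≤ Real.cosh x := by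
  have h1 : Real.cosh x = 1 + 2 * Real.sinh (x / 2) ^ 2 := by
    have := Real.cosh_two_mul (x / 2)
    rw [mul_div_cancel₀ _ two_ne_zero, Real.cosh_sq'] at this
    linarith
  have h2 : x / 2 ≤ Real.sinh (x / 2) := Real.self_le_sinh_iff.2 (by positivity)
  rw [h1]
  nlinarith

theorem cosh_le_of_le_three_tenths {x : ℝ} (h0 : 0 ≤ x) (hx : x ≤ 0.3) :
    Real.cosh x ≤ 1 + 0.504 * x ^ 2 := by
  have habs : |x| ≤ 1 := by
    rw [abs_of_nonneg h0]
    linarith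
  have h1 := (abs_le.1 (Real.exp_bound habs (n := 6) (by norm_num))).2
  have h2 := (abs_le.1 (Real.exp_bound ((abs_neg x).trans_le habs) (n := 6) (by norm_num))).2
  rw [abs_neg] at h2
  rw [abs_of_nonneg h0] at h1 h2
  norm_num [Finset.sum_range_succ, Nat.factorial] at h1 h2
  have hx2 : x ^ 2 ≤ 0.09 := by nlinarith
  have hx4 : x ^ 4 ≤ 0.09 * x ^ 2 := by nlinarith [sq_nonneg x]
  have hx6 : x ^ 6 ≤ 0.09 * x ^ 4 := by nlinarith [pow_nonneg h0 4]
  rw [Real.cosh_eq]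
  nlinarith [sq_nonneg x]

/-- On `[0, π]` one has `1 - cos x ≥ 2x²/π²`; angles beyond `π` reduce to this by `k ↦ n - k`. -/
theorem eight_div_sq_le_one_sub_cos {k n : ℕ} (hk : 0 < k) (hkn : k < n) :
    8 / (n : ℝ) ^ 2 ≤ 1 - Real.cos (k * (2 * Real.pi / n)) := by
  have hn : (0 : ℝ) < n := by exact_mod_cast hk.trans hkn
  have hpi := Real.pi_pos
  have main : ∀ j : ℕ, 0 < j → 2 * j ≤ n →
      8 / (n : ℝ) ^ 2 ≤ 1 - Real.cos (j * (2 * Real.pi / n)) := by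
    intro j hj hjn
    have hj1 : (1 : ℝ) ≤ j := by exact_mod_cast hj
    have hjn' : 2 * (j : ℝ) ≤ n := by exact_mod_cast hjn
    have h := Real.cos_le_one_sub_mul_cos_sq (x := j * (2 * Real.pi / n)) (by
      rw [abs_of_nonneg (by positivity), show (j : ℝ) * (2 * Real.pi / n) =
        Real.pi * (2 * j / n) by ring]
      exact mul_le_of_le_one_right hpi.le ((div_le_one hn).2 hjn'))
    have h2 : 2 / Real.pi ^ 2 * (j * (2 * Real.pi / n)) ^ 2 = 8 / (n : ℝ) ^ 2 * j ^ 2 := by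
      field_simp
      ring
    rw [h2] at h
    have h3 : 8 / (n : ℝ) ^ 2 * 1 ≤ 8 / (n : ℝ) ^ 2 * j ^ 2 := by
      gcongr
      nlinarith
    linarith
  rcases le_or_gt (2 * k) n with h | h
  · exact main k hk h
  · have h1 := main (n - k) (by omega) (by omega)
    rwa [Nat.cast_sub hkn.le, show ((n : ℝ) - k) * (2 * Real.pi / n) =
      2 * Real.pi - k * (2 * Real.pi / n) by field_simp, Real.cos_two_pi_sub] at h1

/-- If `n` is large compared with `1 / ε` and `T` compared with `n ε`, every power of the isometry
of complex length `1 / n² + 2πi / n` has displacement at least `ε` at distance `arcosh T`. -/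
theorem cosh_le_coshDisp_of_le {n : ℕ} (hn : 0 < n) {ε T : ℝ} (hε0 : 0 ≤ ε) (hε : ε ≤ 0.3)
    (hnε : 7 ≤ (n : ℝ) ^ 2 * ε ^ 2) (hT : 1.0082 * ((n : ℝ) ^ 2 * ε ^ 2) ≤ T ^ 2) {w : ℂ}
    (hre : w.re = 1 / (n : ℝ) ^ 2) (him : w.im = 2 * Real.pi / n) {k : ℕ} (hk : 0 < k) :
    Real.cosh ε ≤ HypSpace.coshDisp w k (T ^ 2 - 1) := by
  have hn' : (0 : ℝ) < n := by exact_mod_cast hn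
  refine (cosh_le_of_le_three_tenths hε0 hε).trans ?_
  have hT1 : 0 ≤ T ^ 2 - 1 := by linarith
  unfold HypSpace.coshDisp
  rw [hre, him]
  have hc := Real.one_le_cosh (k * (1 / (n : ℝ) ^ 2))
  have hcos := Real.cos_le_one (k * (2 * Real.pi / n))
  rcases lt_or_ge k n with h | h
  · have h1 := eight_div_sq_le_one_sub_cos hk h
    -- Rotation regime: `1.0082 - 1/7 > 0.8`, so the gain `6.4 ε²` far exceeds `0.504 ε²`.
    have h2 : 8 / (n : ℝ) ^ 2 * (0.8 * ((n : ℝ) ^ 2 * ε ^ 2)) ≤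
        (1 - Real.cos (k * (2 * Real.pi / n))) * (T ^ 2 - 1) :=
      mul_le_mul h1 (by linarith) (by positivity) (by linarith)
    have h3 : 8 / (n : ℝ) ^ 2 * (0.8 * ((n : ℝ) ^ 2 * ε ^ 2)) = 6.4 * ε ^ 2 := by
      field_simp
      ring
    nlinarith [mul_nonneg (sub_nonneg.2 hc) hT1, sq_nonneg ε]
  · have hkn : (n : ℝ) ≤ k := by exact_mod_cast h
    have h1 : 1 / (n : ℝ) ≤ k * (1 / (n : ℝ) ^ 2) := by
      rw [mul_one_div, div_le_div_iff₀ hn' (by positivity)]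
      nlinarith
    have h2 : Real.cosh (1 / n) ≤ Real.cosh (k * (1 / (n : ℝ) ^ 2)) := by
      rw [Real.cosh_le_cosh, abs_of_pos (by positivity), abs_of_nonneg (by positivity)]
      exact h1
    have h3 := (one_add_sq_div_two_le_cosh (x := 1 / (n : ℝ)) (by positivity)).trans h2
    -- Translation regime, with the cosine bounded by `1`. The constant `1.0082 = 2 · 0.5041` is
    -- chosen just to beat `0.504`.
    have h4 : (1 / (n : ℝ)) ^ 2 / 2 * (1.0082 * ((n : ℝ) ^ 2 * ε ^ 2)) ≤
        (Real.cosh (k * (1 / (n : ℝ) ^ 2)) - 1) * T ^ 2 :=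
      mul_le_mul (by linarith) hT (by positivity) (by linarith)
    have h5 : (1 / (n : ℝ)) ^ 2 / 2 * (1.0082 * ((n : ℝ) ^ 2 * ε ^ 2)) = 0.5041 * ε ^ 2 := by
      field_simp
      ring
    nlinarith [mul_nonneg (sub_nonneg.2 hcos) hT1, sq_nonneg ε]

theorem arsinh_sqrt_le_arcosh {S T : ℝ} (hT : 1 ≤ T) (h : S ≤ T ^ 2 - 1) :
    Real.arsinh (√S) ≤ Real.arcosh T := by
  rw [← Real.sinh_le_sinh, Real.sinh_arsinh, Real.sinh_arcosh hT]
  exact Real.sqrt_le_sqrt h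

/-- `cosh (a + b) ≥ cosh a cosh b` for `a, b ≥ 0`, and `cosh 2.15 > e²/2 > 3.6`. The shift `2.15` is
below `2.2 - 0.0424`. -/
theorem arcosh_lt_arcosh_add {x y : ℝ} (hx : 1 ≤ x) (hy : 1 ≤ y) (h : y ≤ 3.5 * x) :
    Real.arcosh y < Real.arcosh x + 2.15 := by
  have h0 := Real.arcosh_nonneg hx
  have h1 : (3.6 : ℝ) < Real.cosh 2.15 := by
    have h2 : Real.exp 1 ^ 2 ≤ Real.exp 2.15 := by
      rw [← Real.exp_nat_mul]
      exact Real.exp_le_exp.2 (by norm_num)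
    have h3 := Real.exp_one_gt_d9
    have h4 := Real.exp_pos (-2.15)
    rw [Real.cosh_eq]
    nlinarith
  have h2 : y < Real.cosh (Real.arcosh x + 2.15) := by
    rw [Real.cosh_add, Real.cosh_arcosh hx]
    have h3 : 0 ≤ Real.sinh (Real.arcosh x) * Real.sinh 2.15 :=
      mul_nonneg (Real.sinh_nonneg_iff.2 h0) (Real.sinh_nonneg_iff.2 (by norm_num))
    nlinarith
  have h3 : (0 : ℝ) ≤ Real.arcosh x + 2.15 := by linarith
  rw [← Real.arcosh_cosh h3]
  exact (Real.arcosh_lt_arcosh (by linarith) (by linarith)).2 h2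

/-! ### The theorem -/

theorem theorem4p4 (δ ε : ℝ) (hδ : 0 < δ) (hδε : Real.sqrt (7.256 * δ) ≤ ε) (hε : ε ≤ 0.3) :
    ∃ (n : ℕ) (lam tau d : ℝ),
      IsLeast {k : ℕ | 0 < k ∧ 1 / (k : ℝ) ^ 2 ≤ δ} n ∧
      lam = 1 / (n : ℝ) ^ 2 ∧ tau = 2 * Real.pi / (n : ℝ) ∧ lam ≤ δ ∧
      SolidTorus.IsTubeDist ((lam : ℂ) + (tau : ℂ) * Complex.I) δ ε d ∧
      d ≤ Real.arcosh (1.116 * (ε / Real.sqrt δ)) ∧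
      d < (Real.arcosh (ε / Real.sqrt (7.256 * δ)) - 0.0424) + 2.2 := by
  have hroot : 0 < √(7.256 * δ) := by positivity
  have hε0 : 0 < ε := hroot.trans_le hδε
  have hδε2 : 7.256 * δ ≤ ε ^ 2 := (Real.sqrt_le_left hε0.le).1 hδε
  have hεsq : ε ^ 2 ≤ 0.09 := by nlinarith
  have hδle : δ ≤ ε := by nlinarith
  obtain ⟨q, hq⟩ : ∃ q, √δ = q := ⟨_, rfl⟩
  have hq0 : 0 < q := hq ▸ Real.sqrt_pos.2 hδ
  have hq2 : q ^ 2 = δ := by rw [← hq, Real.sq_sqrt hδ.le]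
  -- From `q² = δ ≤ 0.09 / 7.256`.
  have hqle : q ≤ 0.111372 := by
    by_contra! h
    nlinarith
  have hex : ∃ k : ℕ, 0 < k ∧ 1 / (k : ℝ) ^ 2 ≤ δ := by
    obtain ⟨m, hm⟩ := exists_nat_gt (1 / q)
    have hm0 : (0 : ℝ) < m := (one_div_pos.2 hq0).trans hm
    refine ⟨m, by exact_mod_cast hm0, ?_⟩
    rw [div_lt_iff₀ hq0] at hm
    rw [div_le_iff₀ (by positivity), ← hq2]
    nlinarith
  classical
  have hleast : IsLeast {k : ℕ | 0 < k ∧ 1 / (k : ℝ) ^ 2 ≤ δ} (Nat.find hex) :=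
    ⟨Nat.find_spec hex, fun k hk => Nat.find_min' hex hk⟩
  generalize Nat.find hex = n at hleast
  obtain ⟨⟨hn, hnδ⟩, hmin⟩ := hleast
  have hn' : (0 : ℝ) < n := by exact_mod_cast hn
  have hδn : 1 ≤ δ * (n : ℝ) ^ 2 := by rwa [div_le_iff₀ (by positivity)] at hnδ
  -- Minimality of `n` means `(n - 1) q < 1`; the case `n = 1` is separate because `n - 1` must be
  -- positive to compete.
  have hnq : n * q < 1 + q := by
    by_contra! h
    have hn1 : n ≠ 1 := by
      rintro rfl
      norm_num at h
    have hcast : ((n - 1 : ℕ) : ℝ) = n - 1 := by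
      rw [Nat.cast_sub hn, Nat.cast_one]
    have hn2 : (1 : ℝ) < n := by exact_mod_cast (show 1 < n by omega)
    have hmem : n ≤ n - 1 := hmin ⟨by omega, by
      rw [hcast, div_le_iff₀ (by nlinarith), ← hq2]
      nlinarith⟩
    omega
  -- `(1 + 0.111372)² < 1.2352`, and `1.0082 · 1.2352 < 1.116²` is what fixes the constant `1.116`.
  have hnq2 : (n : ℝ) ^ 2 * δ ≤ 1.2352 := by
    rw [← hq2]
    nlinarith [mul_pos hn' hq0]
  set T := 1.116 * (ε / q) with hT
  have hT2 : T ^ 2 * δ = 1.245456 * ε ^ 2 := by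
    rw [hT, ← hq2]
    field_simp
    norm_num
  have hTn : 1.0082 * ((n : ℝ) ^ 2 * ε ^ 2) ≤ T ^ 2 := by
    refine le_of_mul_le_mul_right ?_ hδ
    rw [hT2]
    nlinarith [mul_le_mul_of_nonneg_right hnq2 (sq_nonneg ε)]
  have hnε : 7 ≤ (n : ℝ) ^ 2 * ε ^ 2 := by
    nlinarith [mul_le_mul_of_nonneg_left hδε2 (sq_nonneg (n : ℝ))]
  have hT0 : 0 < T := by positivity
  have hT1 : 1 ≤ T := by nlinarith
  obtain ⟨w, hw⟩ : ∃ w : ℂ, ((1 / (n : ℝ) ^ 2 : ℝ) : ℂ) + ((2 * Real.pi / n : ℝ) : ℂ) * Complex.I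
    = w := ⟨_, rfl⟩
  have hre : w.re = 1 / (n : ℝ) ^ 2 := by
    rw [← hw, Complex.add_re, Complex.ofReal_re, Complex.re_ofReal_mul, Complex.I_re, mul_zero,
      add_zero]
  have him : w.im = 2 * Real.pi / n := by
    rw [← hw, Complex.add_im, Complex.ofReal_im, Complex.im_ofReal_mul, Complex.I_im, mul_one,
      zero_add]
  have hw0 : 0 < w.re := by
    rw [hre]
    positivity
  obtain ⟨S, hS, hSle, hSeq⟩ := HypSpace.exists_min_coshDisp_eq hw0 (hre.trans_le hnδ)
  obtain ⟨S', hS', hSle', hSeq'⟩ :=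
    HypSpace.exists_min_coshDisp_eq hw0 (hre.trans_le (hnδ.trans hδle))
  have hST : S' ≤ T ^ 2 - 1 := by
    obtain ⟨k, hk, he⟩ := hSeq'
    rw [← (HypSpace.coshDisp_strictMono hw0 hk).le_iff_le, he]
    exact cosh_le_coshDisp_of_le hn hε0.le hε hnε hTn hre him hk
  have hd : Real.arsinh (√S') - Real.arsinh (√S) ≤ Real.arcosh T := by
    have h1 := arsinh_sqrt_le_arcosh hT1 hST
    have h2 : 0 ≤ Real.arsinh (√S) := Real.arsinh_nonneg_iff.2 (Real.sqrt_nonneg _)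
    linarith
  refine ⟨n, _, _, Real.arsinh (√S') - Real.arsinh (√S), ⟨⟨hn, hnδ⟩, hmin⟩, rfl, rfl, hnδ,
    ?_, ?_, ?_⟩
  · rw [hw]
    exact ⟨_, _, SolidTorus.isTubeRadius_of_min hw0 hδ hS hSle hSeq,
      SolidTorus.isTubeRadius_of_min hw0 hε0 hS' hSle' hSeq', rfl⟩
  · rwa [hq]
  · have h1 : 1 ≤ ε / √(7.256 * δ) := (one_le_div hroot).2 hδε
    -- The ratio is `1.116 √7.256`, at most `1.116 · 3 < 3.5`.
    have h2 : T ≤ 3.5 * (ε / √(7.256 * δ)) := by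
      have h3 : √(7.256 * δ) ≤ 3 * q := by
        rw [Real.sqrt_le_left (by positivity), mul_pow, hq2]
        linarith
      have h4 : ε / (3 * q) ≤ ε / √(7.256 * δ) := by gcongr
      have h5 : ε / (3 * q) = ε / q / 3 := by
        field_simp
      rw [h5] at h4
      have h6 : 0 < ε / q := by positivity
      rw [hT]
      linarith
    have := arcosh_lt_arcosh_add h1 hT1 h2
    linarith
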